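/- Let $\mathcal{A}$ be a finite alphabet and let $\mathcal{F}$ be the free semigroup of all finite words over $\mathcal{A}$ (including the empty word) under concatenation. Write $|w|$ for the length of a word $w$, put $\mu(w)=|\mathcal{A}|^{-|w|}$ and $\mu(B)=\sum_{w\in B}\mu(w)$ for $B\subset\mathcal{F}$, and for a non-empty finite interval $I\subset\mathbb{Z}^+$ put $B(I)=\{w\in B: |w|\in I\}$ and $d^I(B)=\mu(B(I))/\mu(\mathcal{F}(I))$. The upper Banach density of $B$ is $d^*(B)=\limsup_{I\to\infty}d^I(B)$, where $I\to\infty$ means that both $|I|$ and $\min I$ tend to infinity. For a word $w$ let $w\mathcal{F}=\{wv: v\in\mathcal{F}\}$, and let the relative density of $B$ in $w\mathcal{F}$ on $I$ be $d^I_{w\mathcal{F}}(B)=\mu(B(I)\cap w\mathcal{F})/\mu(\mathcal{F}(I)\cap w\mathcal{F})$ if $\min I\ge|w|$, and $0$ otherwise. Let $S\subset\mathcal{F}$. Call a sequence of intervals $(I_j)$ admissible for $S$ if $I_j\to\infty$, $d^{I_j}(S)\to d^*(S)$ and, for every $w\in\mathcal{F}$, $d^{I_j}_{w\mathcal{F}}(S)$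 converges as $j\to\infty$ to a limit $d^{I_\infty}_{w\mathcal{F}}(S)$. (By a diagonal argument every $S$ has admissible sequences.) For such a sequence put $d^{I_\infty}_{\sup}(S)=\sup_{w\in\mathcal{F}}d^{I_\infty}_{w\mathcal{F}}(S)$. For an integer $\ell\ge 2$, the set $S$ is $\ell$-product-free if $x_1x_2\cdots x_\ell\notin S$ for all $x_1,\dots,x_\ell\in S$; for an integer $k\ge2$ it is strongly $k$-product-free if it is $\ell$-product-free for every $\ell=2,\dots,k$. Let $\rho(k)=\min\{\ell\in\mathbb{Z}^+:\ell\nmid k-1\}$. **Theorem.** Let $k\ge2$ be an integer and $S\subset\mathcal{F}$. (a) If $S$ is strongly $k$-product-free, then $d^*(S)\le 1/k$. Moreover, if $d^*(S)=1/k$, then $d^{I_\infty}_{\sup}(S)=1/k$ for every sequence $(I_j)$ admissible for $S$. (b) If $S$ is $k$-product-free, then $d^*(S)\le 1/\rho(k)$. Moreover, if $d^*(S)=1/\rho(k)$, then $d^{I_\infty}_{\sup}(S)=1/\rho(k)$ for every sequence $(I_j)$ admissible for $S$. -/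

import Mathlib

open Filter Topology
open scoped ENNReal

namespace WordDensity

/-!
The free semigroup of the text contains the empty word as identity, so it is `FreeMonoid A`:
finite words over `A` under concatenation.
-/

variable {A : Type*}

/-- `S` is `k`-product-free: `x₁ x₂ ⋯ xₖ ∉ S` for all `x₁, …, xₖ ∈ S`. -/
def ProductFree (k : ℕ) (S : Set (FreeMonoid A)) : Prop :=
  ∀ x : Fin k → FreeMonoid A, (∀ i, x i ∈ S) → (List.ofFn x).prod ∉ S

/-- `S` is strongly `k`-product-free: it is `l`-product-free for every `l = 2, …, k`. -/
def StronglyProductFree (k : ℕ) (S : Set (FreeMonoid A)) : Prop :=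
  ∀ l : ℕ, 2 ≤ l → l ≤ k → ProductFree l S

/-- The least positive integer that does not divide `k - 1` (used for `k ≥ 2` only). -/
noncomputable def rho (k : ℕ) : ℕ :=
  sInf {l : ℕ | 0 < l ∧ ¬ l ∣ k - 1}

/-- The subtree `w𝓕`: all words that have `w` as a prefix. -/
def subtree (w : FreeMonoid A) : Set (FreeMonoid A) :=
  {x | ∃ v : FreeMonoid A, x = w * v}

/-- `B(I)`: the words of `B` whose length lies in `I`. -/
def layers (B : Set (FreeMonoid A)) (I : Finset ℕ) : Set (FreeMonoid A) :=
  {x | x ∈ B ∧ x.length ∈ I}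

/-- The measure on the set of words that gives the word `w` mass `|A|⁻¹ ^ |w|`. -/
noncomputable def mu [Fintype A] (B : Set (FreeMonoid A)) : ℝ≥0∞ :=
  ∑' w : B, ((Fintype.card A : ℝ≥0∞)⁻¹) ^ (w : FreeMonoid A).length

/-- The density `d^I(B) = μ(B(I)) / μ(𝓕(I))`. -/
noncomputable def density [Fintype A] (I : Finset ℕ) (B : Set (FreeMonoid A)) : ℝ :=
  (mu (layers B I) / mu (layers (Set.univ : Set (FreeMonoid A)) I)).toReal

/-- The relative density of `B` in the subtree `w𝓕` on `I`; it is `0` by convention if some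
element of `I` is smaller than `|w|`. -/
noncomputable def relDensity [Fintype A] (I : Finset ℕ) (w : FreeMonoid A)
    (B : Set (FreeMonoid A)) : ℝ :=
  if ∀ n ∈ I, w.length ≤ n then
    (mu (layers B I ∩ subtree w) / mu (layers Set.univ I ∩ subtree w)).toReal
  else 0

/-- The interval with minimum `p.1` and with `p.2` elements. -/
def interval (p : ℕ × ℕ) : Finset ℕ := Finset.Ico p.1 (p.1 + p.2)

/-- The filter `I → ∞` on intervals: both `min I` and `|I|` tend to infinity. -/
def toInfinity : Filter (ℕ × ℕ) := atTop ×ˢ atTop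

/-- The upper Banach density `d*(B) = limsup_{I → ∞} d^I(B)`. -/
noncomputable def upperBanachDensity [Fintype A] (B : Set (FreeMonoid A)) : ℝ :=
  limsup (fun p : ℕ × ℕ => density (interval p) B) toInfinity

/-- The intervals `I j` tend to infinity and realize the upper Banach density of `S`, and, for
every word `w`, the relative densities of `S` in `w𝓕` on the intervals `I j` converge to `δ w`. -/
structure IsLimitDensity [Fintype A] (S : Set (FreeMonoid A)) (I : ℕ → ℕ × ℕ)
    (δ : FreeMonoid A → ℝ) : Prop where
  toInfinity : Tendsto I atTop toInfinity
  realizes : Tendsto (fun j => density (interval (I j)) S) atTop (𝓝 (upperBanachDensity S))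
  converges : ∀ w, Tendsto (fun j => relDensity (interval (I j)) w S) atTop (𝓝 (δ w))

theorem mu_mono [Fintype A] {B C : Set (FreeMonoid A)} (h : B ⊆ C) : mu B ≤ mu C :=
  ENNReal.tsum_mono_subtype
    (fun w : FreeMonoid A => ((Fintype.card A : ℝ≥0∞)⁻¹) ^ w.length) h

theorem toReal_div_mem {a b : ℝ≥0∞} (h : a ≤ b) : (a / b).toReal ∈ Set.Icc (0 : ℝ) 1 := by
  refine ⟨ENNReal.toReal_nonneg, ?_⟩
  have : a / b ≤ 1 := ENNReal.div_le_of_le_mul (by simpa using h)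
  simpa using ENNReal.toReal_mono ENNReal.one_ne_top this

theorem density_mem [Fintype A] (I : Finset ℕ) (B : Set (FreeMonoid A)) :
    density I B ∈ Set.Icc (0 : ℝ) 1 :=
  toReal_div_mem (mu_mono fun _ hx => ⟨trivial, hx.2⟩)

theorem relDensity_mem [Fintype A] (I : Finset ℕ) (w : FreeMonoid A) (B : Set (FreeMonoid A)) :
    relDensity I w B ∈ Set.Icc (0 : ℝ) 1 := by
  unfold relDensity
  split_ifs
  · exact toReal_div_mem (mu_mono fun _ hx => ⟨⟨trivial, hx.1.2⟩, hx.2⟩)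
  · simp

/-- Sequences of intervals as in `IsLimitDensity` exist for every set of words. -/
theorem exists_isLimitDensity [Fintype A] (S : Set (FreeMonoid A)) :
    ∃ I δ, IsLimitDensity S I δ := by
  have hb : IsBoundedUnder (· ≤ ·) toInfinity
      (fun p : ℕ × ℕ => density (interval p) S) :=
    isBoundedUnder_of ⟨1, fun p => (density_mem _ S).2⟩
  have hb' : IsBoundedUnder (· ≥ ·) toInfinity
      (fun p : ℕ × ℕ => density (interval p) S) :=
    isBoundedUnder_of ⟨0, fun p => (density_mem _ S).1⟩
  have : NeBot toInfinity := by unfold toInfinity; infer_instance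
  have key : ∀ j : ℕ, ∃ p : ℕ × ℕ, (j ≤ p.1 ∧ j ≤ p.2) ∧
      upperBanachDensity S - 1 / ((j : ℝ) + 1) < density (interval p) S ∧
      density (interval p) S < upperBanachDensity S + 1 / ((j : ℝ) + 1) := by
    intro j
    have hj : (0 : ℝ) < 1 / ((j : ℝ) + 1) := by positivity
    have h1 : ∃ᶠ p in toInfinity,
        upperBanachDensity S - 1 / ((j : ℝ) + 1) < density (interval p) S :=
      frequently_lt_of_lt_limsup hb'.isCoboundedUnder_le
        (show _ < upperBanachDensity S by linarith)
    have h2 : ∀ᶠ p in toInfinity,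
        density (interval p) S < upperBanachDensity S + 1 / ((j : ℝ) + 1) :=
      eventually_lt_of_limsup_lt (show upperBanachDensity S < _ by linarith) hb
    have h3 : ∀ᶠ p : ℕ × ℕ in toInfinity, j ≤ p.1 ∧ j ≤ p.2 :=
      (eventually_ge_atTop j).prod_mk (eventually_ge_atTop j)
    obtain ⟨p, hp1, hp2, hp3⟩ := (h1.and_eventually (h2.and h3)).exists
    exact ⟨p, hp3, hp1, hp2⟩
  choose J hJ hJ1 hJ2 using key
  have hJt : Tendsto J atTop toInfinity :=
    (tendsto_atTop_mono (fun j => (hJ j).1) tendsto_id).prodMk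
      (tendsto_atTop_mono (fun j => (hJ j).2) tendsto_id)
  have h0 : Tendsto (fun j : ℕ => 1 / ((j : ℝ) + 1)) atTop (𝓝 0) :=
    tendsto_one_div_add_atTop_nhds_zero_nat
  have hJd : Tendsto (fun j => density (interval (J j)) S) atTop
      (𝓝 (upperBanachDensity S)) := by
    refine tendsto_of_tendsto_of_tendsto_of_le_of_le (by simpa using h0.const_sub _)
      (by simpa using h0.const_add (upperBanachDensity S)) (fun j => (hJ1 j).le)
      (fun j => (hJ2 j).le)
  have : Countable (FreeMonoid A) := inferInstanceAs (Countable (List A))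
  have hc : IsCompact (Set.univ.pi fun _ : FreeMonoid A => Set.Icc (0 : ℝ) 1) :=
    isCompact_univ_pi fun _ => isCompact_Icc
  obtain ⟨δ, -, φ, hφ, hδ⟩ := hc.tendsto_subseq
    (x := fun j w => relDensity (interval (J j)) w S)
    (fun j w _ => relDensity_mem _ w S)
  exact ⟨J ∘ φ, δ, hJt.comp hφ.tendsto_atTop, hJd.comp hφ.tendsto_atTop,
    fun w => (tendsto_pi_nhds.1 hδ) w⟩

end WordDensity

open WordDensity

/-! Let `M` be the supremum of the limit densities `δ w`, and suppose `δ 1 + r * M > 1`. Since `δ w`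
is the mean of `δ` over the children of `w`, a nearly maximal value at `w` persists at most words on
any level below `w` (`mul_levelDensity_le`) and, if it is close enough to `M`, at any prescribed
descendant (`sub_apply_mul_le`). So one can build `v 0 = 1`, `v (n + 1) = x * v n` with `x ∈ S`
depending on `n` and every `δ (v (n + 1))` nearly `M`. The densities of `S` below `v 0, v s, …, v (r
* s)` add up to more than 1, hence some `z` puts both `v (i * s) * z` and `v (j * s) * z` in `S`,
where `i < j`. The second word is a product of `(j - i) * s` words of `S` and the first one, so a
word of `S` is a product of `(j - i) * s + 1` words of `S` (`exists_extend`). With `s = 1` and `r =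
k - 1` this refutes strong `k`-product-freeness.

For (b) the words `x` are themselves taken with several known factorizations, so the sets of
available exponents (number of factors minus one) obey the closure rule `ExponentFamily`. A purely
additive argument, `false_of_dvd`, shows that such a family reaches every positive `K` divisible by
all of `1, …, r`; it is used for `K = k - 1` and `r = rho k - 1`.

Hence `δ 1 + r * δ w ≤ 1` for all `w`. Taking `w = 1` bounds the density, and in the extremal case
the inequality says `δ w ≤ δ 1`. -/

namespace WordDensity

open scoped Pointwise

variable {A : Type*} [Fintype A]

/-! ### Proportions on a single level of a subtree. -/

/-- The proportion of the words `z` of length `L` with `w * z ∈ B`. -/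
noncomputable def levelDensity (B : Set (FreeMonoid A)) : ℕ → FreeMonoid A → ℝ
  | 0, w => B.indicator 1 w
  | L + 1, w => (∑ a, levelDensity B L (w * FreeMonoid.of a)) / Fintype.card A

theorem levelDensity_nonneg (B : Set (FreeMonoid A)) (L : ℕ) (w : FreeMonoid A) :
    0 ≤ levelDensity B L w := by
  induction L generalizing w with
  | zero => exact Set.indicator_nonneg (fun _ _ => zero_le_one) _
  | succ L ih => exact div_nonneg (Finset.sum_nonneg fun a _ => ih _) (Nat.cast_nonneg _)

theorem levelDensity_univ [Nonempty A] (L : ℕ) (w : FreeMonoid A) :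
    levelDensity (Set.univ : Set (FreeMonoid A)) L w = 1 := by
  induction L generalizing w with
  | zero => simp [levelDensity]
  | succ L ih => simp [levelDensity, ih]

theorem levelDensity_le_add {B C D : Set (FreeMonoid A)} (h : B ⊆ C ∪ D) (L : ℕ)
    (w : FreeMonoid A) : levelDensity B L w ≤ levelDensity C L w + levelDensity D L w := by
  induction L generalizing w with
  | zero =>
    by_cases hw : w ∈ B
    · rcases h hw with h' | h' <;> simp only [levelDensity, hw, h', Set.indicator_of_mem]
      · exact le_add_of_nonneg_right (Set.indicator_nonneg (fun _ _ => zero_le_one) _)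
      · exact le_add_of_nonneg_left (Set.indicator_nonneg (fun _ _ => zero_le_one) _)
    · simp only [levelDensity, hw, Set.indicator_of_notMem, not_false_eq_true]
      exact add_nonneg (Set.indicator_nonneg (fun _ _ => zero_le_one) _)
        (Set.indicator_nonneg (fun _ _ => zero_le_one) _)
  | succ L ih =>
    simp only [levelDensity]
    rw [← add_div, ← Finset.sum_add_distrib]
    gcongr
    exact ih _

theorem exists_mem_of_levelDensity_pos {B : Set (FreeMonoid A)} {L : ℕ} {w : FreeMonoid A}
    (h : 0 < levelDensity B L w) : ∃ z, w * z ∈ B := by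
  induction L generalizing w with
  | zero =>
    by_contra! hc
    have : w ∉ B := by simpa using hc 1
    simp [levelDensity, this] at h
  | succ L ih =>
    by_contra! hc
    refine h.ne' ?_
    simp only [levelDensity]
    rw [Finset.sum_eq_zero, zero_div]
    intro a _
    by_contra hne
    obtain ⟨z, hz⟩ := ih (lt_of_le_of_ne (levelDensity_nonneg B L _) (Ne.symm hne))
    exact hc (FreeMonoid.of a * z) (by rwa [← mul_assoc])

theorem levelDensity_le_one (B : Set (FreeMonoid A)) (L : ℕ) (w : FreeMonoid A) :
    levelDensity B L w ≤ 1 := by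
  induction L generalizing w with
  | zero => exact Set.indicator_le_self' (fun _ _ => zero_le_one) w
  | succ L ih =>
    refine div_le_one_of_le₀ ?_ (Nat.cast_nonneg _)
    simpa using Finset.sum_le_sum fun a (_ : a ∈ Finset.univ) => ih (w * FreeMonoid.of a)

/-- If the sets `{z | v i * z ∈ B i}` are pairwise disjoint, then their proportions at a level add
up to at most one. -/
theorem sum_levelDensity_le_one {ι : Type*} (J : Finset ι) (B : ι → Set (FreeMonoid A)) (L : ℕ)
    (v : ι → FreeMonoid A)
    (h : ∀ z, ∀ i ∈ J, ∀ j ∈ J, v i * z ∈ B i → v j * z ∈ B j → i = j) :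
    ∑ i ∈ J, levelDensity (B i) L (v i) ≤ 1 := by
  induction L generalizing v with
  | zero =>
    by_cases hex : ∃ i ∈ J, v i ∈ B i
    · obtain ⟨i, hi, hiB⟩ := hex
      rw [Finset.sum_eq_single_of_mem i hi]
      · exact levelDensity_le_one _ _ _
      · intro j hj hne
        have : v j ∉ B j := fun hjB => hne (h 1 j hj i hi (by simpa) (by simpa))
        simp [levelDensity, this]
    · push Not at hex
      rw [Finset.sum_eq_zero]
      · exact zero_le_one
      · intro j hj
        simp [levelDensity, hex j hj]
  | succ L ih =>
    simp only [levelDensity]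
    rw [← Finset.sum_div, Finset.sum_comm]
    refine div_le_one_of_le₀ ?_ (Nat.cast_nonneg _)
    have : ∀ a ∈ (Finset.univ : Finset A),
        ∑ i ∈ J, levelDensity (B i) L (v i * FreeMonoid.of a) ≤ 1 := fun a _ =>
      ih (fun i => v i * FreeMonoid.of a) fun z i hi j hj h1 h2 =>
        h (FreeMonoid.of a * z) i hi j hj (by rwa [← mul_assoc]) (by rwa [← mul_assoc])
    simpa using Finset.sum_le_sum this

/-! ### Relative densities as averages of level proportions. -/

theorem mu_biUnion {ι : Type*} (s : Finset ι) (t : ι → Set (FreeMonoid A))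
    (hd : (s : Set ι).Pairwise (Function.onFun Disjoint t)) :
    mu (⋃ i ∈ s, t i) = ∑ i ∈ s, mu (t i) :=
  Summable.tsum_finset_bUnion_disjoint
    (f := fun w : FreeMonoid A => ((Fintype.card A : ℝ≥0∞)⁻¹) ^ w.length) hd
    fun _ _ => ENNReal.summable

omit [Fintype A] in
theorem subtree_mul_subset (w v : FreeMonoid A) : subtree (w * v) ⊆ subtree w := by
  rintro x ⟨z, rfl⟩
  exact ⟨v * z, mul_assoc _ _ _⟩

theorem layers_singleton_inter_subtree (B : Set (FreeMonoid A)) (L : ℕ) (w : FreeMonoid A) :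
    layers B {w.length + (L + 1)} ∩ subtree w =
      ⋃ a ∈ (Finset.univ : Finset A),
        layers B {(w * FreeMonoid.of a).length + L} ∩ subtree (w * FreeMonoid.of a) := by
  ext x
  simp only [layers, Finset.mem_singleton, Set.mem_inter_iff, Set.mem_ofPred_eq, Finset.mem_univ,
    Set.iUnion_true, Set.mem_iUnion, FreeMonoid.length_mul, FreeMonoid.length_of]
  constructor
  · rintro ⟨⟨hB, hl⟩, v, rfl⟩
    rw [FreeMonoid.length_mul] at hl
    induction v using FreeMonoid.casesOn with
    | one => simp at hl
    | of_mul a v =>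
      refine ⟨a, ⟨hB, ?_⟩, v, (mul_assoc _ _ _).symm⟩
      rw [FreeMonoid.length_mul]
      omega
  · rintro ⟨a, ⟨hB, hl⟩, hs⟩
    exact ⟨⟨hB, by omega⟩, subtree_mul_subset _ _ hs⟩

omit [Fintype A] in
theorem disjoint_subtree (w : FreeMonoid A) {a b : A} (h : a ≠ b) :
    Disjoint (subtree (w * FreeMonoid.of a)) (subtree (w * FreeMonoid.of b)) := by
  rw [Set.disjoint_left]
  rintro x ⟨u, rfl⟩ ⟨v, hv⟩
  rw [mul_assoc, mul_assoc, mul_right_inj] at hv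
  exact h (List.cons.inj hv).1

theorem mu_layers_singleton_inter_subtree [Nonempty A] (B : Set (FreeMonoid A)) (L : ℕ)
    (w : FreeMonoid A) :
    mu (layers B {w.length + L} ∩ subtree w) =
      ENNReal.ofReal (levelDensity B L w / (Fintype.card A : ℝ) ^ w.length) := by
  have hc : (0 : ℝ) < Fintype.card A := Nat.cast_pos.2 Fintype.card_pos
  induction L generalizing w with
  | zero =>
    by_cases hw : w ∈ B
    · have : layers B {w.length + 0} ∩ subtree w = {w} := by
        ext x
        simp only [layers, add_zero, Finset.mem_singleton, Set.mem_inter_iff, Set.mem_ofPred_eq,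
          Set.mem_singleton_iff]
        constructor
        · rintro ⟨⟨hB, hl⟩, v, rfl⟩
          rw [FreeMonoid.length_mul, Nat.add_eq_left, FreeMonoid.length_eq_zero] at hl
          rw [hl, mul_one]
        · rintro rfl
          exact ⟨⟨hw, rfl⟩, 1, by simp⟩
      have hmu : mu {w} = ((Fintype.card A : ℝ≥0∞)⁻¹) ^ w.length :=
        tsum_singleton w fun x : FreeMonoid A => ((Fintype.card A : ℝ≥0∞)⁻¹) ^ x.length
      rw [this, hmu]
      simp only [levelDensity, Set.indicator_of_mem hw, Pi.one_apply, one_div]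
      rw [ENNReal.ofReal_inv_of_pos (by positivity), ENNReal.ofReal_pow hc.le,
        ENNReal.ofReal_natCast]
      exact ENNReal.inv_pow.symm
    · have : layers B {w.length + 0} ∩ subtree w = ∅ := by
        ext x
        simp only [layers, add_zero, Finset.mem_singleton, Set.mem_inter_iff, Set.mem_ofPred_eq,
          Set.mem_empty_iff_false, iff_false]
        rintro ⟨⟨hB, hl⟩, v, rfl⟩
        rw [FreeMonoid.length_mul, Nat.add_eq_left, FreeMonoid.length_eq_zero] at hl
        rw [hl, mul_one] at hB
        exact hw hB
      rw [this]
      simp [mu, levelDensity, hw]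
  | succ L ih =>
    rw [layers_singleton_inter_subtree, mu_biUnion]
    · simp_rw [ih]
      rw [← ENNReal.ofReal_sum_of_nonneg]
      · congr 1
        simp only [levelDensity, FreeMonoid.length_mul, FreeMonoid.length_of]
        rw [← Finset.sum_div, div_div, pow_succ']
      · exact fun a _ => div_nonneg (levelDensity_nonneg _ _ _) (by positivity)
    · intro a _ b _ hab
      exact (disjoint_subtree w hab).mono Set.inter_subset_right Set.inter_subset_right

theorem mu_layers_inter_subtree [Nonempty A] (B : Set (FreeMonoid A)) (I : Finset ℕ)
    (w : FreeMonoid A) (hI : ∀ n ∈ I, w.length ≤ n) :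
    mu (layers B I ∩ subtree w) = ENNReal.ofReal
      ((∑ n ∈ I, levelDensity B (n - w.length) w) / (Fintype.card A : ℝ) ^ w.length) := by
  have : layers B I ∩ subtree w = ⋃ n ∈ I, layers B {n} ∩ subtree w := by
    ext x
    simp only [layers, Set.mem_inter_iff, Set.mem_ofPred_eq, Finset.mem_singleton, Set.mem_iUnion,
      exists_prop]
    constructor
    · rintro ⟨⟨h1, h2⟩, h3⟩
      exact ⟨_, h2, ⟨h1, rfl⟩, h3⟩
    · rintro ⟨n, hn, ⟨h1, rfl⟩, h3⟩
      exact ⟨⟨h1, hn⟩, h3⟩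
  rw [this, mu_biUnion]
  · rw [Finset.sum_div, ENNReal.ofReal_sum_of_nonneg]
    · refine Finset.sum_congr rfl fun n hn => ?_
      rw [← mu_layers_singleton_inter_subtree, Nat.add_sub_cancel' (hI n hn)]
    · exact fun n _ => div_nonneg (levelDensity_nonneg _ _ _) (by positivity)
  · intro m _ n _ hmn
    rw [Function.onFun, Set.disjoint_left]
    rintro x ⟨⟨_, h1⟩, _⟩ ⟨⟨_, h2⟩, _⟩
    exact hmn (by simp_all)

theorem relDensity_eq [Nonempty A] (B : Set (FreeMonoid A)) (I : Finset ℕ)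
    (w : FreeMonoid A) (hI : ∀ n ∈ I, w.length ≤ n) :
    relDensity I w B = (∑ n ∈ I, levelDensity B (n - w.length) w) / I.card := by
  have hc : (0 : ℝ) < Fintype.card A := Nat.cast_pos.2 Fintype.card_pos
  rw [relDensity, if_pos hI, mu_layers_inter_subtree B I w hI, mu_layers_inter_subtree _ I w hI,
    ENNReal.toReal_div, ENNReal.toReal_ofReal, ENNReal.toReal_ofReal]
  · simp only [levelDensity_univ, Finset.sum_const, nsmul_eq_mul, mul_one]
    rw [div_div_div_cancel_right₀ (by positivity)]
  · exact div_nonneg (Finset.sum_nonneg fun _ _ => levelDensity_nonneg _ _ _) (by positivity)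
  · exact div_nonneg (Finset.sum_nonneg fun _ _ => levelDensity_nonneg _ _ _) (by positivity)

theorem relDensity_one (B : Set (FreeMonoid A)) (I : Finset ℕ) :
    relDensity I 1 B = density I B := by
  have : subtree (1 : FreeMonoid A) = Set.univ :=
    Set.eq_univ_of_forall fun x => ⟨x, (one_mul x).symm⟩
  simp [relDensity, density, this]

theorem relDensity_of_isEmpty [IsEmpty A] (B : Set (FreeMonoid A)) (I : Finset ℕ)
    (w : FreeMonoid A) (hI : 0 ∉ I) : relDensity I w B = 0 := by
  have : layers B I = ∅ := by
    ext x
    simp only [layers, Set.mem_ofPred_eq, Set.mem_empty_iff_false, iff_false]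
    rintro ⟨_, h⟩
    have hx : x = 1 := by
      induction x using FreeMonoid.casesOn with
      | one => rfl
      | of_mul a _ => exact isEmptyElim a
    exact hI (by simpa [hx] using h)
  simp [relDensity, this, mu]

/-! ### Additive combinatorics of exponent sets. -/

/-- If `D` contains `c * x` for `x ≤ l` and for `x` in the window `[b, T]`, then the `N`-fold
sumset of `D` contains `c * x` for `x` in the window `[b, N * T]`. -/
theorem mul_mem_nsmul_of_window {D : Set ℕ} {c l b T : ℕ} (hl : ∀ x ≤ l, c * x ∈ D)
    (hw : ∀ x, b ≤ x → x ≤ T → c * x ∈ D) (hbT : b ≤ T) (hT : 2 * b ≤ T + l + 1) {N : ℕ}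
    (hN : 1 ≤ N) : ∀ x, b ≤ x → x ≤ N * T → c * x ∈ N • D := by
  have h0 : 0 ∈ D := by simpa using hl 0 (Nat.zero_le _)
  induction N, hN using Nat.le_induction with
  | base => intro x h1 h2; simpa using hw x h1 (by simpa using h2)
  | succ N hN ih =>
    intro x h1 h2
    have hNT : T ≤ N * T := Nat.le_mul_of_pos_left T hN
    rw [succ_nsmul]
    rw [add_one_mul] at h2
    obtain ⟨y, z, hy, hz, rfl⟩ : ∃ y z, c * y ∈ N • D ∧ c * z ∈ D ∧ x = y + z := by
      rcases le_or_gt x T with hx | hx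
      · exact ⟨0, x, by simpa using Set.zero_mem_nsmul h0, hw x h1 hx, by simp⟩
      rcases le_or_gt (2 * b) x with hb | hb
      · refine ⟨x - min T (x - b), min T (x - b), ih _ ?_ ?_, hw _ ?_ ?_, ?_⟩ <;> omega
      -- In the gap `T < x < 2 * b` the remainder `x - T` is at most `l` by `hT`, so the initial
      -- segment supplies it.
      · exact ⟨T, x - T, ih T hbT hNT, hl _ (by omega), by omega⟩
    rw [mul_add]
    exact Set.add_mem_add hy hz

/-- The exponents obtained by putting together `N` words with exponents in `D` and one more word. -/
def extendExponents (D : Set ℕ) (N : ℕ) : Set ℕ :=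
  insert 0 ((N + ·) '' (N • D))

theorem add_mem_extendExponents {D : Set ℕ} {N x : ℕ} (h : x ∈ N • D) :
    N + x ∈ extendExponents D N :=
  Or.inr ⟨x, h, rfl⟩

/-- A family of sets of natural numbers that contains `{0}` and subsets of its members, and, with
each member `D` and each `s`, contains `extendExponents D (i * s)` for some `1 ≤ i ≤ r`. -/
structure ExponentFamily (r : ℕ) (P : Set ℕ → Prop) : Prop where
  mono : ∀ ⦃D E⦄, D ⊆ E → P E → P D
  zero : P {0}
  step : ∀ D, P D → ∀ s, 1 ≤ s → ∃ i, 1 ≤ i ∧ i ≤ r ∧ P (extendExponents D (i * s))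

namespace ExponentFamily

variable {r K : ℕ} {P : Set ℕ → Prop}

theorem exists_pair (h : ExponentFamily r P) : ∃ c, 1 ≤ c ∧ c ≤ r ∧ P {0, c} := by
  obtain ⟨i, h1, h2, h3⟩ := h.step {0} h.zero 1 le_rfl
  refine ⟨i, h1, h2, h.mono ?_ h3⟩
  rintro x (rfl | rfl)
  · exact Or.inl rfl
  · simpa using add_mem_extendExponents (N := x * 1) (Set.zero_mem_nsmul (Set.mem_singleton 0))

/-- If the family has no `{0, c}` with `0 < c < r`, then it contains all `{0, r, …, m * r}`. -/
theorem multiples_mem (h : ExponentFamily r P) (hmin : ∀ c, 1 ≤ c → P {0, c} → r ≤ c) (m : ℕ) :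
    P {x | ∃ j ≤ m, x = r * j} := by
  induction m with
  | zero =>
    refine h.mono ?_ h.zero
    rintro x ⟨j, hj, rfl⟩
    simp_all
  | succ m ih =>
    obtain ⟨i, h1, h2, h3⟩ := h.step _ ih 1 le_rfl
    rw [mul_one] at h3
    have hD : ∀ x ≤ m, r * x ∈ {x | ∃ j ≤ m, x = r * j} := fun x hx => ⟨x, hx, rfl⟩
    have hN : ∀ x ≤ m, r * x ∈ i • {x | ∃ j ≤ m, x = r * j} := fun x hx =>
      mul_mem_nsmul_of_window (b := 0) (T := m) hD (fun x _ => hD x) (Nat.zero_le _) (by simp) h1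
        x (Nat.zero_le _) (hx.trans (Nat.le_mul_of_pos_left m h1))
    -- The extension contains `i` itself, so minimality leaves only `i = r`, and the multiples of
    -- `r` are shifted by exactly one place.
    have hir : i = r := by
      refine le_antisymm h2 (hmin i h1 (h.mono ?_ h3))
      rintro x (rfl | rfl)
      · exact Or.inl rfl
      · simpa using add_mem_extendExponents (hN 0 (Nat.zero_le _))
    subst hir
    refine h.mono ?_ h3
    rintro x ⟨j, hj, rfl⟩
    rcases j with _ | j
    · exact Or.inl (by simp)
    · rw [mul_add_one, add_comm]
      exact add_mem_extendExponents (hN j (by omega))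

/-- A pair `{0, c}` with `c + 1 = r` leads to `K` in one step. -/
theorem not_pair_pred (h : ExponentFamily r P) (hK : 0 < K) (hdvd : ∀ i, 1 ≤ i → i ≤ r → i ∣ K)
    (havoid : ∀ D, P D → K ∉ D) {c : ℕ} (hc : 1 ≤ c) (hcr : c + 1 = r) : ¬ P {0, c} := by
  intro hP
  obtain ⟨s, hs⟩ := hdvd r (by omega) le_rfl
  have hcs : c ∣ s := by
    have : c ∣ r * s := hs ▸ hdvd c hc (by omega)
    refine Nat.Coprime.dvd_of_dvd_mul_left ?_ this
    rw [← hcr]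
    simp
  obtain ⟨t, rfl⟩ := hcs
  have ht : 1 ≤ t := Nat.pos_of_ne_zero (by rintro rfl; simp at hs; omega)
  -- The step size is `K / r`. With `e = r - i`, `K` is the shift `i * (c * t)` plus `e * t` copies
  -- of `c`; there are enough summands because `e = c + 1 - i ≤ i * c`.
  obtain ⟨i, h1, h2, h3⟩ := h.step _ hP (c * t) (Nat.mul_pos hc ht)
  obtain ⟨e, rfl⟩ := Nat.exists_eq_add_of_le h2
  refine havoid _ h3 ?_
  have h01 : ∀ x, 0 ≤ x → x ≤ 1 → c * x ∈ ({0, c} : Set ℕ) := by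
    intro x _ hx
    interval_cases x <;> simp
  have key := mul_mem_nsmul_of_window (l := 0) (N := i * (c * t)) (fun x hx => h01 x (by omega)
    (by omega)) h01 (by simp) (by simp) (Nat.mul_pos h1 (Nat.mul_pos hc ht)) (e * t)
    (Nat.zero_le _) (by
      have : e ≤ i * c := by nlinarith
      nlinarith)
  have := add_mem_extendExponents key
  convert this using 1
  rw [hs]
  ring

/-- The consecutive numbers `r` and `r - 1` are coprime and both divide `K`. -/
theorem mul_pred_le (hK : 0 < K) (hdvd : ∀ i, 1 ≤ i → i ≤ r → i ∣ K) (hr : 2 ≤ r) :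
    r * (r - 1) ≤ K := by
  refine Nat.le_of_dvd hK (Nat.Coprime.mul_dvd_of_dvd_of_dvd ?_ (hdvd r (by omega) le_rfl)
    (hdvd _ (by omega) (by omega)))
  obtain ⟨c, rfl⟩ := Nat.exists_eq_add_of_le' (show 1 ≤ r by omega)
  simp

/-- The windows generated from a pair `{0, c}` with `2 ≤ c ≤ r - 2` grow until they contain `K`. -/
theorem not_pair_of_two_le (h : ExponentFamily r P) (hK : 0 < K)
    (hdvd : ∀ i, 1 ≤ i → i ≤ r → i ∣ K) (havoid : ∀ D, P D → K ∉ D) {c : ℕ} (hc : 2 ≤ c)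
    (hcr : c + 2 ≤ r) : ¬ P {0, c} := by
  intro hP
  have hKr := mul_pred_le hK hdvd (by omega)
  obtain ⟨q, rfl⟩ := hdvd c (by omega) (by omega)
  have hq : r * (1 + c) ≤ c * q := le_trans (Nat.mul_le_mul_left r (by omega)) hKr
  have hqr : r ≤ q := by nlinarith
  -- Stepping with `s = c` keeps shifts divisible by `c`. The ratio `1 + c` keeps the start of the
  -- next window at most `q = K / c`, so its end must stay below `q`; yet `T` grows at every step.
  have window : ∀ n : ℕ, ∃ b T, n ≤ T ∧ 1 ≤ b ∧ (1 + c) * b ≤ T ∧ T < q ∧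
      P {x | x = 0 ∨ ∃ y, b ≤ y ∧ y ≤ T ∧ x = c * y} := by
    intro n
    induction n with
    | zero =>
      obtain ⟨i, h1, h2, h3⟩ := h.step _ hP c (by omega)
      have h01 : ∀ x, 0 ≤ x → x ≤ 1 → c * x ∈ ({0, c} : Set ℕ) := by
        intro x _ hx
        interval_cases x <;> simp
      have key := mul_mem_nsmul_of_window (l := 0) (N := i * c) (fun x hx => h01 x (by omega)
        (by omega)) h01 (by simp) (by simp) (Nat.mul_pos h1 (by omega))
      have key' : ∀ y, i ≤ y → y ≤ (1 + c) * i → c * y ∈ extendExponents {0, c} (i * c) := by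
        intro y hy1 hy2
        have := add_mem_extendExponents (key (y - i) (Nat.zero_le _) (by
          rw [Nat.sub_le_iff_le_add]; linarith))
        convert this using 1
        rw [mul_comm i c, ← mul_add, Nat.add_sub_cancel' hy1]
      refine ⟨i, (1 + c) * i, Nat.zero_le _, h1, le_rfl, ?_, h.mono ?_ h3⟩
      · by_contra! hlt
        exact havoid _ h3 (key' q (by omega) hlt)
      · rintro x (rfl | ⟨y, hy1, hy2, rfl⟩)
        · exact Or.inl rfl
        · exact key' y hy1 hy2
    | succ n ih =>
      obtain ⟨b, T, hn, hb, hbT, hTq, hD⟩ := ih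
      obtain ⟨i, h1, h2, h3⟩ := h.step _ hD c (by omega)
      have key := mul_mem_nsmul_of_window (D := {x | x = 0 ∨ ∃ y, b ≤ y ∧ y ≤ T ∧ x = c * y})
        (l := 0) (b := b) (T := T) (c := c) (N := i * c)
        (fun x hx => Or.inl (by simp [Nat.le_zero.1 hx]))
        (fun x hx1 hx2 => Or.inr ⟨x, hx1, hx2, rfl⟩) (by nlinarith) (by nlinarith)
        (Nat.mul_pos h1 (by omega))
      have key' : ∀ y, i + b ≤ y → y ≤ i * (1 + c * T) → c * y ∈ extendExponents
          {x | x = 0 ∨ ∃ y, b ≤ y ∧ y ≤ T ∧ x = c * y} (i * c) := by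
        intro y hy1 hy2
        have := add_mem_extendExponents (key (y - i) (by omega) (by
          rw [Nat.sub_le_iff_le_add]; linarith))
        convert this using 1
        rw [mul_comm i c, ← mul_add, Nat.add_sub_cancel' (by omega)]
      refine ⟨i + b, i * (1 + c * T), ?_, by omega, ?_, ?_, h.mono ?_ h3⟩
      · nlinarith [Nat.mul_le_mul h1 (Nat.mul_le_mul (show 1 ≤ c by omega) hn)]
      · have e1 : c * i * ((1 + c) * b) ≤ c * i * T := Nat.mul_le_mul_left _ hbT
        have e2 : 1 * 2 ≤ i * c := Nat.mul_le_mul h1 hc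
        have e3 : 3 * 1 ≤ (1 + c) * b := Nat.mul_le_mul (by omega) hb
        nlinarith [Nat.mul_le_mul e2 e3]
      · by_contra! hlt
        refine havoid _ h3 (key' q ?_ hlt)
        have : (r + b) * (1 + c) ≤ q * (1 + c) := by nlinarith
        have := Nat.le_of_mul_le_mul_right this (by omega)
        omega
      · rintro x (rfl | ⟨y, hy1, hy2, rfl⟩)
        · exact Or.inl rfl
        · exact key' y hy1 hy2
  obtain ⟨b, T, hn, -, -, hT, -⟩ := window q
  omega

/-- Take the longest initial segment `[0, m]` in the family, and a window `[b, T]` with the largest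
`T`. A step with `i ≥ 2` would give a larger window, so every step is a shift by one. After `m + 1`
shifts the accumulated initial segment is `[0, m + 1]`, contradicting the choice of `m`. -/
theorem not_pair_one (h : ExponentFamily r P) (hK : 0 < K)
    (hdvd : ∀ i, 1 ≤ i → i ≤ r → i ∣ K) (havoid : ∀ D, P D → K ∉ D) (hr : 3 ≤ r) :
    ¬ P {0, 1} := by
  intro hP
  have hKr := mul_pred_le hK hdvd (by omega)
  have hrK : 3 * r ≤ K + 3 := by
    rcases Nat.lt_or_ge r 4 with h4 | h4
    · have : r = 3 := by omega
      subst this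
      omega
    · have : r * 3 ≤ r * (r - 1) := Nat.mul_le_mul_left r (by omega)
      omega
  obtain ⟨m, ⟨hm1, hPm⟩, hmax⟩ : ∃ m, (1 ≤ m ∧ P (Set.Iic m)) ∧
      ∀ n, 1 ≤ n ∧ P (Set.Iic n) → n ≤ m := by
    have hex : ∃ m, 1 ≤ m ∧ P (Set.Iic m) := by
      refine ⟨1, le_rfl, h.mono (fun x hx => ?_) hP⟩
      have : x ≤ 1 := hx
      interval_cases x <;> simp
    have hbdd : BddAbove {m | 1 ≤ m ∧ P (Set.Iic m)} := by
      refine ⟨K, fun m hm => ?_⟩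
      by_contra! hlt
      exact havoid _ hm.2 hlt.le
    exact ⟨_, Nat.sSup_mem hex hbdd, fun n hn => le_csSup hbdd hn⟩
  have hPm' : ¬ P (Set.Iic (m + 1)) := fun hc => by
    have := hmax (m + 1) ⟨by omega, hc⟩
    omega
  let W : ℕ → Prop := fun T => ∃ b, 1 ≤ b ∧ 2 * b ≤ T ∧ 2 * m + 2 ≤ T ∧ T < K ∧
    P {x | x = 0 ∨ (b ≤ x ∧ x ≤ T)}
  have hWex : ∃ T, W T := by
    obtain ⟨i, h1, h2, h3⟩ := h.step _ hPm 1 le_rfl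
    rw [mul_one] at h3
    have key := mul_mem_nsmul_of_window (D := Set.Iic m) (l := 0) (b := 0) (T := m) (c := 1)
      (N := i) (fun x hx => by simp; omega) (fun x _ hx => by simpa using hx) (by simp) (by simp)
      h1
    have key' : ∀ y, i ≤ y → y ≤ i * (m + 1) → y ∈ extendExponents (Set.Iic m) i := by
      intro y hy1 hy2
      have := add_mem_extendExponents (key (y - i) (by omega) (by
          rw [Nat.sub_le_iff_le_add]; linarith))
      rwa [one_mul, Nat.add_sub_cancel' hy1] at this
    -- A shift by one would already extend `[0, m]` to `[0, m + 1]`.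
    have hi : i ≠ 1 := by
      rintro rfl
      refine hPm' (h.mono (fun x hx => ?_) h3)
      rcases x.eq_zero_or_pos with rfl | hx0
      · exact Or.inl rfl
      · exact key' x hx0 (by simpa using hx)
    have hi2 : 2 ≤ i := by omega
    refine ⟨i * (m + 1), i, h1, by nlinarith, by nlinarith, ?_, h.mono ?_ h3⟩
    · by_contra! hlt
      exact havoid _ h3 (key' K (by omega) hlt)
    · rintro x (rfl | ⟨hx1, hx2⟩)
      · exact Or.inl rfl
      · exact key' x hx1 hx2
  have hWb : BddAbove {T | W T} := ⟨K, fun T hT => by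
    obtain ⟨b, -, -, -, hT, -⟩ := hT
    exact hT.le⟩
  have hWmax : ∀ T, W T → T ≤ sSup {T | W T} := fun T hT => le_csSup hWb hT
  obtain ⟨b, hb, hbT, hmT, hTK, hD⟩ : W (sSup {T | W T}) := Nat.sSup_mem hWex hWb
  generalize sSup {T | W T} = T at *
  have shift : ∀ l ≤ m, T + l < K → P {x | x ≤ l ∨ (b + l ≤ x ∧ x ≤ T + l)} →
      T + l + 1 < K ∧ P {x | x ≤ l + 1 ∨ (b + (l + 1) ≤ x ∧ x ≤ T + (l + 1))} := by
    intro l hl hTl hPl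
    obtain ⟨i, h1, h2, h3⟩ := h.step _ hPl 1 le_rfl
    rw [mul_one] at h3
    rcases h1.eq_or_lt with rfl | hi
    · have hmem : ∀ x, (x ≤ l ∨ (b + l ≤ x ∧ x ≤ T + l)) → 1 + x ∈
          extendExponents {x | x ≤ l ∨ (b + l ≤ x ∧ x ≤ T + l)} 1 := fun x hx =>
        add_mem_extendExponents (by rwa [one_nsmul])
      constructor
      · by_contra! hlt
        refine havoid _ h3 ?_
        have := hmem (K - 1) (Or.inr ⟨by omega, by omega⟩)
        rwa [Nat.add_sub_cancel' hK] at this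
      · refine h.mono (fun x hx => ?_) h3
        rcases x with _ | x
        · exact Or.inl rfl
        · rw [Nat.add_comm x 1]
          refine hmem x ?_
          rcases hx with hx | hx
          · exact Or.inl (by omega)
          · exact Or.inr (by omega)
    · exfalso
      have key := mul_mem_nsmul_of_window (D := {x | x ≤ l ∨ (b + l ≤ x ∧ x ≤ T + l)}) (l := l)
        (b := b + l) (T := T + l) (c := 1) (N := i) (fun x hx => by simpa using Or.inl hx)
        (fun x hx1 hx2 => by simpa using Or.inr ⟨hx1, hx2⟩) (by omega) (by omega) h1
      have key' : ∀ y, i + (b + l) ≤ y → y ≤ i * (1 + T + l) → y ∈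
          extendExponents {x | x ≤ l ∨ (b + l ≤ x ∧ x ≤ T + l)} i := by
        intro y hy1 hy2
        have := add_mem_extendExponents (key (y - i) (by omega) (by
          rw [Nat.sub_le_iff_le_add]; linarith))
        rwa [one_mul, Nat.add_sub_cancel' (by omega)] at this
      have hgrow : 2 * (1 + T + l) ≤ i * (1 + T + l) := Nat.mul_le_mul_right _ hi
      have hW : W (i * (1 + T + l)) := by
        refine ⟨i + (b + l), by omega, ?_, by omega, ?_, h.mono ?_ h3⟩
        · obtain ⟨e, rfl⟩ := Nat.exists_eq_add_of_le' (show 2 ≤ i from hi)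
          nlinarith [Nat.zero_le (e * (T + l - 1)), Nat.mul_le_mul_left e (show 2 ≤ T by omega)]
        -- `K` is not below the window: `2 * b ≤ T`, `2 * l + 2 ≤ T` and `T + l < K` give `b + l ≤ 2
        -- * K / 3 - 1`, while `hrK` gives `i ≤ K / 3 + 1`.
        · by_contra! hlt
          exact havoid _ h3 (key' K (by omega) hlt)
        · rintro x (rfl | ⟨hx1, hx2⟩)
          · exact Or.inl rfl
          · exact key' x hx1 hx2
      have := hWmax _ hW
      omega
  have run : ∀ l ≤ m + 1, T + l < K ∧ P {x | x ≤ l ∨ (b + l ≤ x ∧ x ≤ T + l)} := by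
    intro l
    induction l with
    | zero =>
      refine fun _ => ⟨hTK, h.mono (fun x hx => ?_) hD⟩
      rcases hx with hx | hx
      · exact Or.inl (Nat.le_zero.1 hx)
      · exact Or.inr hx
    | succ l ih =>
      intro hl
      obtain ⟨h1, h2⟩ := ih (by omega)
      exact shift l (by omega) h1 h2
  exact hPm' (h.mono (fun x hx => Or.inl hx) (run (m + 1) le_rfl).2)

theorem false_of_dvd (h : ExponentFamily r P) (hr : 1 ≤ r) (hK : 0 < K)
    (hdvd : ∀ i, 1 ≤ i → i ≤ r → i ∣ K) (havoid : ∀ D, P D → K ∉ D) : False := by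
  by_cases hmin : ∀ c, 1 ≤ c → P {0, c} → r ≤ c
  · obtain ⟨q, hq⟩ := hdvd r hr le_rfl
    exact havoid _ (h.multiples_mem hmin q) ⟨q, le_rfl, hq⟩
  · push Not at hmin
    obtain ⟨c, hc, hP, hcr⟩ := hmin
    rcases (show c + 1 ≤ r from hcr).eq_or_lt with h' | h'
    · exact h.not_pair_pred hK hdvd havoid hc h' hP
    rcases hc.eq_or_lt with rfl | hc
    · exact h.not_pair_one hK hdvd havoid h' hP
    · exact h.not_pair_of_two_le hK hdvd havoid hc h' hP

end ExponentFamily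

/-! ### Limit densities as an averaging function on the tree of words. -/

theorem mem_Icc_of_isLimitDensity {S : Set (FreeMonoid A)} {I : ℕ → ℕ × ℕ}
    {δ : FreeMonoid A → ℝ} (h : IsLimitDensity S I δ) (w : FreeMonoid A) :
    δ w ∈ Set.Icc (0 : ℝ) 1 :=
  isClosed_Icc.mem_of_tendsto (h.converges w) (Eventually.of_forall fun _ => relDensity_mem _ _ _)

theorem IsLimitDensity.apply_one {S : Set (FreeMonoid A)} {I : ℕ → ℕ × ℕ}
    {δ : FreeMonoid A → ℝ} (h : IsLimitDensity S I δ) : δ 1 = upperBanachDensity S := by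
  refine tendsto_nhds_unique (h.converges 1) ?_
  simpa only [relDensity_one] using h.realizes

theorem IsLimitDensity.eventually_le {S : Set (FreeMonoid A)} {I : ℕ → ℕ × ℕ}
    {δ : FreeMonoid A → ℝ} (h : IsLimitDensity S I δ) (m : ℕ) :
    ∀ᶠ j in atTop, ∀ n ∈ interval (I j), m ≤ n := by
  have h1 : Tendsto (fun j => (I j).1) atTop atTop := tendsto_fst.comp h.toInfinity
  filter_upwards [h1.eventually_ge_atTop m] with j hj n hn
  exact hj.trans (Finset.mem_Ico.1 hn).1

theorem IsLimitDensity.tendsto_length {S : Set (FreeMonoid A)} {I : ℕ → ℕ × ℕ}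
    {δ : FreeMonoid A → ℝ} (h : IsLimitDensity S I δ) : Tendsto (fun j => (I j).2) atTop atTop :=
  tendsto_snd.comp h.toInfinity

theorem IsLimitDensity.average [Nonempty A] {S : Set (FreeMonoid A)} {I : ℕ → ℕ × ℕ}
    {δ : FreeMonoid A → ℝ} (h : IsLimitDensity S I δ) (w : FreeMonoid A) :
    δ w = (∑ a, δ (w * FreeMonoid.of a)) / Fintype.card A := by
  refine tendsto_nhds_unique (h.converges w)
    (((tendsto_finsetSum Finset.univ fun a _ =>
      h.converges (w * FreeMonoid.of a)).div_const _).congr' ?_)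
  filter_upwards [h.eventually_le (w.length + 1)] with j hj
  rw [relDensity_eq S _ w fun n hn => (Nat.le_succ _).trans (hj n hn)]
  have : ∀ a, relDensity (interval (I j)) (w * FreeMonoid.of a) S =
      (∑ n ∈ interval (I j), levelDensity S (n - (w.length + 1)) (w * FreeMonoid.of a)) /
        (interval (I j)).card := by
    intro a
    have hl : (w * FreeMonoid.of a).length = w.length + 1 := by
      rw [FreeMonoid.length_mul, FreeMonoid.length_of]
    rw [relDensity_eq _ _ _ (by rwa [hl]), hl]
  simp_rw [this]
  rw [← Finset.sum_div, div_right_comm, Finset.sum_comm, Finset.sum_div]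
  congr 1
  refine Finset.sum_congr rfl fun n hn => ?_
  obtain ⟨L, rfl⟩ := Nat.exists_eq_add_of_le (hj n hn)
  rw [Nat.add_sub_cancel_left, show w.length + 1 + L - w.length = L + 1 by omega]
  rfl

theorem abs_sum_range_shift_sub_le {f : ℕ → ℝ} (h0 : ∀ n, 0 ≤ f n) (h1 : ∀ n, f n ≤ 1) (q m : ℕ) :
    |∑ n ∈ Finset.range q, f (n + m) - ∑ n ∈ Finset.range q, f n| ≤ m := by
  induction m with
  | zero => simp
  | succ m ih =>
    have e1 := Finset.sum_range_succ (fun n => f (n + m)) q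
    have e2 := Finset.sum_range_succ' (fun n => f (n + m)) q
    have e3 : ∑ n ∈ Finset.range q, f (n + (m + 1)) = ∑ n ∈ Finset.range q, f (n + 1 + m) :=
      Finset.sum_congr rfl fun n _ => by congr 1; ring
    rw [abs_le] at ih ⊢
    push_cast
    simp only [zero_add] at e2
    constructor <;> linarith [h0 m, h1 m, h0 (q + m), h1 (q + m), ih.1, ih.2]

/-- The averages of `levelDensity S L w` over `L ∈ I j` tend to `δ w`. -/
theorem IsLimitDensity.tendsto_average_level [Nonempty A] {S : Set (FreeMonoid A)}
    {I : ℕ → ℕ × ℕ} {δ : FreeMonoid A → ℝ} (h : IsLimitDensity S I δ) (w : FreeMonoid A) :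
    Tendsto (fun j => (∑ L ∈ interval (I j), levelDensity S L w) / (I j).2) atTop
      (𝓝 (δ w)) := by
  have hlim : Tendsto (fun j => (w.length : ℝ) / (I j).2) atTop (𝓝 0) :=
    (tendsto_const_nhds.div_atTop (tendsto_natCast_atTop_atTop.comp h.tendsto_length))
  have hdiff : Tendsto (fun j => (∑ L ∈ interval (I j), levelDensity S L w) / (I j).2 -
      relDensity (interval (I j)) w S) atTop (𝓝 0) := by
    -- Measuring levels from `w` instead of from the root shifts the interval by `|w|`, which is
    -- negligible against its length. This allows one common level `L` below words of different
    -- lengths.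
    refine squeeze_zero_norm' ?_ hlim
    filter_upwards [h.eventually_le w.length, h.tendsto_length.eventually_ge_atTop w.length]
      with j hj hj'
    rw [relDensity_eq S _ w hj]
    have hcard : (interval (I j)).card = (I j).2 := by simp [interval]
    rw [hcard, ← sub_div, norm_div, Real.norm_natCast]
    gcongr
    by_cases h0 : (I j).2 = 0
    · simp [interval, h0]
    have hw : w.length ≤ (I j).1 := hj _ (by simp [interval]; omega)
    obtain ⟨p, hp⟩ := Nat.exists_eq_add_of_le hw
    rw [interval, Finset.sum_Ico_eq_sum_range, Finset.sum_Ico_eq_sum_range,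
      Nat.add_sub_cancel_left]
    have e1 : ∀ n, (I j).1 + n = n + w.length + p := fun n => by omega
    have e2 : ∀ n, (I j).1 + n - w.length = n + p := fun n => by omega
    simp_rw [e2, e1]
    exact abs_sum_range_shift_sub_le (f := fun n => levelDensity S (n + p) w)
      (fun _ => levelDensity_nonneg _ _ _) (fun _ => levelDensity_le_one _ _ _) (I j).2 w.length
  simpa using hdiff.add (h.converges w)

/-- Markov's inequality for the nonnegative function `M - δ`, whose mean over level `L` below `v` is
`M - δ v`. -/
theorem IsLimitDensity.mul_levelDensity_le [Nonempty A] {S B : Set (FreeMonoid A)}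
    {I : ℕ → ℕ × ℕ} {δ : FreeMonoid A → ℝ} (h : IsLimitDensity S I δ) {M η : ℝ}
    (hM : ∀ w, δ w ≤ M) (hB : ∀ x ∈ B, δ x ≤ M - η) (L : ℕ) (v : FreeMonoid A) :
    η * levelDensity B L v ≤ M - δ v := by
  have hc : (0 : ℝ) < Fintype.card A := Nat.cast_pos.2 Fintype.card_pos
  induction L generalizing v with
  | zero =>
    by_cases hv : v ∈ B
    · simpa [levelDensity, hv, le_sub_comm] using hB v hv
    · simpa [levelDensity, hv] using hM v
  | succ L ih =>
    rw [h.average v, levelDensity, mul_div_assoc', Finset.mul_sum, div_le_iff₀ hc, sub_mul,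
      div_mul_cancel₀ _ hc.ne']
    refine (Finset.sum_le_sum fun a _ => ih (v * FreeMonoid.of a)).trans_eq ?_
    rw [Finset.sum_sub_distrib]
    simp [mul_comm]

/-- The deficits `M - δ` of the children are nonnegative and sum to `|A|` times that of the parent,
so each letter costs at most a factor `|A|`. -/
theorem IsLimitDensity.sub_apply_mul_le [Nonempty A] {S : Set (FreeMonoid A)}
    {I : ℕ → ℕ × ℕ} {δ : FreeMonoid A → ℝ} (h : IsLimitDensity S I δ) {M : ℝ}
    (hM : ∀ w, δ w ≤ M) (x v : FreeMonoid A) :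
    M - δ (x * v) ≤ (Fintype.card A : ℝ) ^ v.length * (M - δ x) := by
  have hc : (0 : ℝ) < Fintype.card A := Nat.cast_pos.2 Fintype.card_pos
  induction v using FreeMonoid.recOn generalizing x with
  | one => simp
  | of_mul a v ih =>
    rw [← mul_assoc, FreeMonoid.length_mul, FreeMonoid.length_of, add_comm, pow_succ,
      mul_assoc (_ ^ _)]
    refine (ih (x * FreeMonoid.of a)).trans ?_
    gcongr
    have := Finset.single_le_sum (f := fun a => M - δ (x * FreeMonoid.of a))
      (fun a _ => sub_nonneg.2 (hM _)) (Finset.mem_univ a)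
    refine this.trans_eq ?_
    rw [h.average x, mul_sub, mul_div_cancel₀ _ hc.ne', Finset.sum_sub_distrib]
    simp

/-- If the limit densities `δ (v i)` add up to more than `a`, then so do the densities of `S` below
the words `v i` on some level. -/
theorem IsLimitDensity.exists_level [Nonempty A] {S : Set (FreeMonoid A)}
    {I : ℕ → ℕ × ℕ} {δ : FreeMonoid A → ℝ} (h : IsLimitDensity S I δ) {ι : Type*}
    (J : Finset ι) (v : ι → FreeMonoid A) {a : ℝ} (ha : a < ∑ i ∈ J, δ (v i)) :
    ∃ L, a < ∑ i ∈ J, levelDensity S L (v i) := by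
  have ht := tendsto_finsetSum J fun i _ => h.tendsto_average_level (v i)
  obtain ⟨j, hj, hj'⟩ := ((ht.eventually_const_lt ha).and
    (h.tendsto_length.eventually_ge_atTop 1)).exists
  by_contra! hc
  refine hj.not_ge ?_
  rw [← Finset.sum_div, Finset.sum_comm, div_le_iff₀ (by exact_mod_cast hj')]
  refine (Finset.sum_le_sum fun L _ => hc L).trans_eq ?_
  simp [interval, mul_comm]

/-! ### Exponents realized by words of nearly maximal density. -/

/-- Some words of `S` have relative limit density almost `M` and are products of `n + 1` words
of `S` for every `n ∈ D`. -/
def HasExponents (S : Set (FreeMonoid A)) (δ : FreeMonoid A → ℝ) (M : ℝ) (D : Set ℕ) : Prop :=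
  ∀ ε > 0, ∃ x ∈ S, M - ε < δ x ∧ ∀ n ∈ D, x ∈ S ^ (n + 1)

-- Each factor with exponent `d` splits into `d + 1` words, so `N` factors contribute `N` beyond the
-- sum of their exponents; this is the shift in `extendExponents`.
omit [Fintype A] in
theorem mem_pow_add_of_mem_nsmul {S T : Set (FreeMonoid A)} {D : Set ℕ}
    (hT : ∀ x ∈ T, ∀ n ∈ D, x ∈ S ^ (n + 1)) {N : ℕ} {y : FreeMonoid A} (hy : y ∈ T ^ N) {n : ℕ}
    (hn : n ∈ N • D) : y ∈ S ^ (N + n) := by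
  induction N generalizing y n with
  | zero => simp_all
  | succ N ih =>
    rw [pow_succ] at hy
    rw [succ_nsmul] at hn
    obtain ⟨y, hy, x, hx, rfl⟩ := hy
    obtain ⟨n, hn, m, hm, rfl⟩ := hn
    have : N + 1 + (n + m) = (N + n) + (m + 1) := by ring
    simp only [this, pow_add _ (N + n) (m + 1)]
    exact Set.mul_mem_mul (ih hy hn) (hT x hx m hm)

theorem IsLimitDensity.hasExponents_zero [Nonempty A] {S : Set (FreeMonoid A)}
    {I : ℕ → ℕ × ℕ} {δ : FreeMonoid A → ℝ} (h : IsLimitDensity S I δ) {M : ℝ} (hM0 : 0 < M)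
    (hM : IsLUB (Set.range δ) M) : HasExponents S δ M {0} := by
  intro ε hε
  have hM' : ∀ w, δ w ≤ M := fun w => hM.1 ⟨w, rfl⟩
  -- Below a word `v` with `δ v > M - ε'`, some level has a proportion of `S` above `ε' / ε`, while
  -- words with `δ ≤ M - ε` take up less than `ε' / ε` of it.
  obtain ⟨ε', hε', hsmall⟩ : ∃ ε' > 0, ε' / ε + ε' < M := by
    refine ⟨M * ε / (2 * (1 + ε)), by positivity, ?_⟩
    rw [div_add' _ _ _ hε.ne', div_lt_iff₀ hε, ← sub_pos]
    have : M * ε - (M * ε / (2 * (1 + ε)) + M * ε / (2 * (1 + ε)) * ε) = M * ε / 2 := by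
      field_simp; ring
    rw [this]
    positivity
  obtain ⟨_, ⟨v, rfl⟩, hv, -⟩ := hM.exists_between (sub_lt_self M hε')
  obtain ⟨L, hL⟩ := h.exists_level {()} (fun _ => v) (a := ε' / ε) (by simp; linarith)
  simp only [Finset.sum_singleton] at hL
  have hbad : levelDensity {x ∈ S | δ x ≤ M - ε} L v < ε' / ε := by
    rw [lt_div_iff₀ hε, mul_comm]
    have := h.mul_levelDensity_le hM' (B := {x ∈ S | δ x ≤ M - ε}) (fun x hx => hx.2) L v
    linarith
  have hadd := levelDensity_le_add (B := S) (C := {x ∈ S | M - ε < δ x})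
    (D := {x ∈ S | δ x ≤ M - ε}) (fun x hx => (lt_or_ge (M - ε) (δ x)).imp
      (fun h' => ⟨hx, h'⟩) (fun h' => ⟨hx, h'⟩)) L v
  obtain ⟨z, hz⟩ := exists_mem_of_levelDensity_pos
    (show 0 < levelDensity {x ∈ S | M - ε < δ x} L v by linarith)
  exact ⟨_, hz.1, hz.2, by simpa using hz.1⟩

theorem IsLimitDensity.exists_extend [Nonempty A] {S : Set (FreeMonoid A)}
    {I : ℕ → ℕ × ℕ} {δ : FreeMonoid A → ℝ} (h : IsLimitDensity S I δ) {M : ℝ}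
    (hM : ∀ w, δ w ≤ M) {r : ℕ} (hsum : 1 < δ 1 + r * M) {D : Set ℕ}
    (hD : HasExponents S δ M D) {s : ℕ} (hs : 1 ≤ s) {η : ℝ} (hη : 0 < η) :
    ∃ i, 1 ≤ i ∧ i ≤ r ∧ ∃ x ∈ S, M - η < δ x ∧ ∀ n ∈ extendExponents D (i * s),
      x ∈ S ^ (n + 1) := by
  have hc : (0 : ℝ) < Fintype.card A := Nat.cast_pos.2 Fintype.card_pos
  obtain ⟨ε, hε, hsmall⟩ : ∃ ε > 0, r * (ε / η) + r * ε < δ 1 + r * M - 1 := by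
    have ht : Tendsto (fun ε : ℝ => r * (ε / η) + r * ε) (𝓝[>] 0) (𝓝 0) := by
      have : Continuous fun ε : ℝ => r * (ε / η) + r * ε := by fun_prop
      simpa using (this.tendsto 0).mono_left nhdsWithin_le_nhds
    obtain ⟨ε, h1, h2⟩ := ((ht.eventually_lt_const
      (show (0 : ℝ) < δ 1 + r * M - 1 by linarith)).and self_mem_nhdsWithin).exists
    exact ⟨ε, h2, h1⟩
  let T : Set (FreeMonoid A) := {x ∈ S | ∀ n ∈ D, x ∈ S ^ (n + 1)}
  have hext : ∀ w, ∃ x ∈ T, M - ε < δ (x * w) := by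
    intro w
    -- The factor is chosen after `w` and put in front of it, so the loss `|A| ^ |w|` is known in
    -- advance.
    obtain ⟨x, hxS, hx, hxD⟩ := hD (ε / (Fintype.card A : ℝ) ^ w.length) (by positivity)
    refine ⟨x, ⟨hxS, hxD⟩, ?_⟩
    have h1 := h.sub_apply_mul_le hM x w
    rw [sub_lt_comm, lt_div_iff₀ (by positivity), mul_comm] at hx
    linarith
  choose f hfT hf using hext
  let v : ℕ → FreeMonoid A := fun n => Nat.rec 1 (fun _ w => f w * w) n
  have hv : ∀ n, M - ε < δ (v (n + 1)) := fun n => hf _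
  have hvT : ∀ m n, ∃ y ∈ T ^ m, v (m + n) = y * v n := by
    intro m n
    induction m with
    | zero => exact ⟨1, by simp, by simp⟩
    | succ m ih =>
      obtain ⟨y, hy, hyv⟩ := ih
      refine ⟨f (v (m + n)) * y, by rw [pow_succ']; exact Set.mul_mem_mul (hfT _) hy, ?_⟩
      rw [mul_assoc, ← hyv, Nat.add_right_comm]
  -- Only the larger index of a colliding pair must give a word of nearly maximal density. Index `0`
  -- is never the larger one, so there all of `S` is allowed, and `δ 1` need not be near `M`.
  let B : ℕ → Set (FreeMonoid A) := fun i => if i = 0 then S else {x ∈ S | M - η < δ x}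
  have hBS : ∀ i, B i ⊆ S := fun i x hx => by
    by_cases hi : i = 0
    · simpa [B, hi] using hx
    · exact (show x ∈ {x ∈ S | M - η < δ x} by simpa [B, hi] using hx).1
  have hvs : ∀ i, M - ε < δ (v ((i + 1) * s)) := by
    intro i
    obtain ⟨m, hm⟩ := Nat.exists_eq_add_of_le' (show 1 ≤ (i + 1) * s from
      Nat.mul_pos (Nat.succ_pos i) hs)
    exact hm ▸ hv m
  obtain ⟨L, hL⟩ := h.exists_level (Finset.range (r + 1)) (fun i => v (i * s))
    (a := 1 + r * (ε / η)) (by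
      rw [Finset.sum_range_succ', zero_mul]
      have := Finset.sum_le_sum fun i (_ : i ∈ Finset.range r) => (hvs i).le
      simp only [Finset.sum_const, Finset.card_range, nsmul_eq_mul] at this
      change _ < _ + δ 1
      linarith)
  have hlarge : 1 < ∑ i ∈ Finset.range (r + 1), levelDensity (B i) L (v (i * s)) := by
    rw [Finset.sum_range_succ'] at hL ⊢
    have hstep : ∀ i ∈ Finset.range r, levelDensity S L (v ((i + 1) * s)) - ε / η ≤
        levelDensity (B (i + 1)) L (v ((i + 1) * s)) := by
      intro i _
      have hbad : levelDensity {x ∈ S | δ x ≤ M - η} L (v ((i + 1) * s)) ≤ ε / η := by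
        rw [le_div_iff₀ hη, mul_comm]
        have := h.mul_levelDensity_le hM (B := {x ∈ S | δ x ≤ M - η}) (fun x hx => hx.2) L
          (v ((i + 1) * s))
        linarith [hvs i]
      have hadd := levelDensity_le_add (B := S) (C := B (i + 1)) (D := {x ∈ S | δ x ≤ M - η})
        (fun x hx => (lt_or_ge (M - η) (δ x)).imp
          (fun h' => by simpa [B] using ⟨hx, h'⟩) (fun h' => ⟨hx, h'⟩)) L (v ((i + 1) * s))
      linarith
    have := Finset.sum_le_sum hstep
    simp only [Finset.sum_sub_distrib, Finset.sum_const, Finset.card_range, nsmul_eq_mul] at this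
    have hB0 : B 0 = S := if_pos rfl
    rw [hB0]
    linarith
  obtain ⟨z, i, j, hj, hij, hi, hj'⟩ : ∃ z, ∃ i j, j ≤ r ∧ i < j ∧ v (i * s) * z ∈ B i ∧
      v (j * s) * z ∈ B j := by
    by_contra! hcon
    refine hlarge.not_ge (sum_levelDensity_le_one _ B L _ fun z i hi j hj h1 h2 => ?_)
    rw [Finset.mem_range, Nat.lt_succ_iff] at hi hj
    rcases lt_trichotomy i j with h' | h' | h'
    · exact (hcon z i j hj h' h1 h2).elim
    · exact h'
    · exact (hcon z j i hi h' h2 h1).elim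
  have hj0 : j ≠ 0 := by omega
  have hjB : v (j * s) * z ∈ {x ∈ S | M - η < δ x} := by simpa [B, hj0] using hj'
  refine ⟨j - i, by omega, by omega, _, hjB.1, hjB.2, ?_⟩
  rintro n (rfl | ⟨m, hm, rfl⟩)
  · simpa using hjB.1
  · obtain ⟨y, hy, hyv⟩ := hvT ((j - i) * s) (i * s)
    rw [← add_mul, Nat.sub_add_cancel hij.le] at hyv
    rw [hyv, mul_assoc, pow_succ]
    exact Set.mul_mem_mul (mem_pow_add_of_mem_nsmul (fun x hx => hx.2) hy hm) (hBS i hi)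

omit [Fintype A] in
theorem HasExponents.mono {S : Set (FreeMonoid A)} {δ : FreeMonoid A → ℝ} {M : ℝ} {D E : Set ℕ}
    (h : D ⊆ E) (hE : HasExponents S δ M E) : HasExponents S δ M D := fun ε hε => by
  obtain ⟨x, hxS, hx, hxE⟩ := hE ε hε
  exact ⟨x, hxS, hx, fun n hn => hxE n (h hn)⟩

/-- If the limit densities are large, then the sets of exponents form an `ExponentFamily`. -/
theorem IsLimitDensity.exponentFamily [Nonempty A] {S : Set (FreeMonoid A)}
    {I : ℕ → ℕ × ℕ} {δ : FreeMonoid A → ℝ} (h : IsLimitDensity S I δ) {M : ℝ} (hM0 : 0 < M)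
    (hM : IsLUB (Set.range δ) M) {r : ℕ} (hsum : 1 < δ 1 + r * M) :
    ExponentFamily r (HasExponents S δ M) where
  mono _ _ := HasExponents.mono
  zero := h.hasExponents_zero hM0 hM
  step D hD s hs := by
    -- The index from `exists_extend` depends on the tolerance. If every `i ≤ r` failed at some
    -- tolerance, the least of these finitely many would rule out all of them at once.
    by_contra! hcon
    have hbad : ∀ i, ∃ ε > 0, 1 ≤ i → i ≤ r → ∀ x ∈ S, M - ε < δ x →
        ∃ n ∈ extendExponents D (i * s), x ∉ S ^ (n + 1) := by
      intro i
      by_cases hi : 1 ≤ i ∧ i ≤ r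
      · have := hcon i hi.1 hi.2
        simp only [HasExponents] at this
        push Not at this
        obtain ⟨ε, hε, h'⟩ := this
        exact ⟨ε, hε, fun _ _ => h'⟩
      · exact ⟨1, one_pos, fun h1 h2 => (hi ⟨h1, h2⟩).elim⟩
    choose ε hε hε' using hbad
    have hne : (Finset.range (r + 1)).Nonempty := ⟨0, by simp⟩
    obtain ⟨i, h1, h2, x, hxS, hx, hxE⟩ := h.exists_extend (fun w => hM.1 ⟨w, rfl⟩) hsum hD hs
      (η := (Finset.range (r + 1)).inf' hne ε) (by simpa [Finset.lt_inf'_iff] using fun i _ => hε i)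
    have hle : (Finset.range (r + 1)).inf' hne ε ≤ ε i :=
      Finset.inf'_le _ (Finset.mem_range.2 (by omega))
    obtain ⟨n, hn, hn'⟩ := hε' i h1 h2 x hxS (by linarith)
    exact hn' (hxE n hn)

/-! ### From product-freeness to density bounds. -/

omit [Fintype A] in
theorem ProductFree.notMem_pow {k : ℕ} {S : Set (FreeMonoid A)} (h : ProductFree k S)
    {x : FreeMonoid A} (hx : x ∈ S) : x ∉ S ^ k := by
  rintro hxk
  obtain ⟨f, rfl⟩ := Set.mem_pow.1 hxk
  exact h (fun i => f i) (fun i => (f i).2) hx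

omit [Fintype A] in
theorem HasExponents.not_productFree {S : Set (FreeMonoid A)} {δ : FreeMonoid A → ℝ} {M : ℝ}
    {D : Set ℕ} (h : HasExponents S δ M D) {n : ℕ} (hn : n ∈ D) : ¬ ProductFree (n + 1) S := by
  obtain ⟨x, hxS, -, hx⟩ := h 1 one_pos
  exact fun hS => hS.notMem_pow hxS (hx n hn)

/-- The bound on limit densities when the exponents of `S` do not form an `ExponentFamily`. -/
theorem IsLimitDensity.add_mul_le_one {S : Set (FreeMonoid A)} {I : ℕ → ℕ × ℕ}
    {δ : FreeMonoid A → ℝ} (h : IsLimitDensity S I δ) {r : ℕ}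
    (hS : ∀ M, ¬ ExponentFamily r (HasExponents S δ M)) (w : FreeMonoid A) :
    δ 1 + r * δ w ≤ 1 := by
  cases isEmpty_or_nonempty A
  -- Over the empty alphabet the only word is empty, so intervals avoiding `0` give `0 / 0 = 0`.
  · have h0 : ∀ w, δ w = 0 := fun w => by
      refine tendsto_nhds_unique (h.converges w) (tendsto_const_nhds.congr' ?_)
      filter_upwards [h.eventually_le 1] with j hj
      exact (relDensity_of_isEmpty _ _ _ fun hn => by simpa using hj 0 hn).symm
    simp [h0]
  by_contra! hlt
  have hbdd : BddAbove (Set.range δ) :=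
    ⟨1, by rintro _ ⟨w, rfl⟩; exact (mem_Icc_of_isLimitDensity h w).2⟩
  have hM : IsLUB (Set.range δ) (⨆ w, δ w) := isLUB_ciSup hbdd
  have hsum : 1 < δ 1 + r * ⨆ w, δ w := hlt.trans_le (by gcongr; exact le_ciSup hbdd w)
  have hM0 : 0 < ⨆ w, δ w := by
    by_contra! hle
    have h1 : δ 1 ≤ ⨆ w, δ w := le_ciSup hbdd 1
    have := mul_nonpos_of_nonneg_of_nonpos (Nat.cast_nonneg (α := ℝ) r) hle
    linarith
  exact hS _ (h.exponentFamily hM0 hM hsum)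

/-- The bound on the upper Banach density and its extremal case when the exponents of `S` do not form
an `ExponentFamily`. -/
theorem density_bound {S : Set (FreeMonoid A)} {r : ℕ} (hr : 1 ≤ r)
    (hS : ∀ δ M, ¬ ExponentFamily r (HasExponents S δ M)) {q : ℝ} (hq : q = r + 1) :
    upperBanachDensity S ≤ 1 / q ∧ (upperBanachDensity S = 1 / q →
      ∀ (I : ℕ → ℕ × ℕ) (δ : FreeMonoid A → ℝ), IsLimitDensity S I δ →
        IsLUB (Set.range δ) (1 / q)) := by
  have hr' : (0 : ℝ) < r := Nat.cast_pos.2 hr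
  have hq0 : 0 < q := by linarith
  constructor
  · obtain ⟨I, δ, h⟩ := exists_isLimitDensity S
    have := h.add_mul_le_one (hS δ) 1
    rw [← h.apply_one, le_div_iff₀ hq0, hq]
    linarith
  · intro heq I δ h
    have h1 : δ 1 = 1 / q := h.apply_one.trans heq
    refine ⟨?_, fun u hu => h1 ▸ hu ⟨1, rfl⟩⟩
    rintro _ ⟨w, rfl⟩
    have h2 := h.add_mul_le_one (hS δ) w
    have h3 : 1 / q * q = 1 := one_div_mul_cancel hq0.ne'
    rw [h1] at h2
    have h4 : 1 / q + r * (1 / q) = 1 := by rw [hq]; field_simp; ring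
    exact le_of_mul_le_mul_left (by linarith) hr'

end WordDensity

open WordDensity
theorem theorem3p1 {A : Type*} [Fintype A] (k : ℕ) (hk : 2 ≤ k) (S : Set (FreeMonoid A)) :
    (StronglyProductFree k S →
      upperBanachDensity S ≤ 1 / (k : ℝ) ∧
      (upperBanachDensity S = 1 / (k : ℝ) →
        ∀ (I : ℕ → ℕ × ℕ) (δ : FreeMonoid A → ℝ), IsLimitDensity S I δ →
          IsLUB (Set.range δ) (1 / (k : ℝ)))) ∧
    (ProductFree k S →
      upperBanachDensity S ≤ 1 / (rho k : ℝ) ∧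
      (upperBanachDensity S = 1 / (rho k : ℝ) →
        ∀ (I : ℕ → ℕ × ℕ) (δ : FreeMonoid A → ℝ), IsLimitDensity S I δ →
          IsLUB (Set.range δ) (1 / (rho k : ℝ)))) := by
  -- Exponents count factors minus one, so products of `k` words have exponent `K = k - 1`.
  obtain ⟨K, rfl⟩ := Nat.exists_eq_add_of_le' (show 1 ≤ k by omega)
  constructor
  · intro hS
    refine density_bound (r := K) (by omega) (fun δ M h => ?_) (by push_cast; ring)
    obtain ⟨c, hc, hcK, hP⟩ := h.exists_pair
    exact hP.not_productFree (Or.inr rfl) (hS (c + 1) (by omega) (by omega))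
  · intro hS
    have hmem : rho (K + 1) ∈ {l : ℕ | 0 < l ∧ ¬ l ∣ K + 1 - 1} :=
      Nat.sInf_mem ⟨K + 1, Nat.succ_pos K, Nat.not_dvd_of_pos_of_lt (by omega) (by omega)⟩
    have hrho : 2 ≤ rho (K + 1) := by
      by_contra! hlt
      have : rho (K + 1) = 1 := by have := hmem.1; omega
      exact hmem.2 (by rw [this]; exact one_dvd _)
    refine density_bound (r := rho (K + 1) - 1) (by omega) (fun δ M h => ?_)
      (by rw [Nat.cast_sub (by omega)]; simp)
    refine h.false_of_dvd (K := K) (by omega) (by omega) (fun i h1 h2 => ?_)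
      fun D hD hKD => hD.not_productFree hKD hS
    by_contra hdvd
    exact Nat.notMem_of_lt_sInf (show i < rho (K + 1) by omega) ⟨h1, hdvd⟩
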